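/- Let $m\ge 2$ and let $\mathcal H=\bigotimes_{k=1}^m\mathbb C^{d_k}$ be the Hilbert space of $m$ players $A_1,\dots,A_m$. Let $\mathcal E=\{\eta_i,\rho_i\}_{i=0}^{1}$ be an ensemble of two states on $\mathcal H$, that is, $\eta_0,\eta_1\ge 0$, $\eta_0+\eta_1=1$, and $\rho_0,\rho_1$ are density operators. Let $\mathsf X=\{\mathbf A,\mathbf B\}$ be a partition of $\{A_1,\dots,A_m\}$ into two nonempty sets, and let $\Gamma_{\mathsf X}$ be the partial transposition with respect to $\mathsf X$, that is, the transposition, in the product basis, of the tensor factors of one of the two parties of $\mathsf X$ (either one may be chosen). For a positive integer $L$ and $\vec c=(c_1,\dots,c_L)\in\{0,1\}^L$ put $\eta_{\vec c}=\prod_{l}\eta_{c_l}$ and $\rho_{\vec c}=\bigotimes_l\rho_{c_l}$, where each player holds its share of all $L$ copies, and for $i\in\{0,1\}$ $$\eta_i^{(L)}=\sum_{\vec c:\ \sum_l c_l\equiv i\ (\mathrm{mod}\ 2)}\eta_{\vec c},\qquad \rho_i^{(L)}=\frac1{\eta_i^{(L)}}\sum_{\vec c:\ \sum_l c_l\equiv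 i\ (\mathrm{mod}\ 2)}\eta_{\vec c}\,\rho_{\vec c}$$ (if $\eta_i^{(L)}=0$, the operator $\rho_i^{(L)}$ plays no role and is set to $0$), and $\mathcal E^{(L)}=\{\eta_i^{(L)},\rho_i^{(L)}\}_{i=0}^1$. Let $$p_{\mathsf X}(\mathcal E^{(L)})=\max_{M}\sum_{i=0}^1\eta_i^{(L)}\operatorname{Tr}\big(\rho_i^{(L)}M_i\big),\qquad q_{\mathsf X}(\mathcal E^{(L)})=\max_{M}\sum_{i=0}^1\eta_i^{(L)}\operatorname{Tr}\big(\Gamma_{\mathsf X}(\rho_i^{(L)})M_i\big),$$ where in the first case $M=\{M_0,M_1\}$ runs over the measurements that can be realized by (finitely many rounds of) local operations and classical communication between the two parties of $\mathsf X$, and in the second case over all measurements (POVMs) on $\mathcal H^{\otimes L}$. If $\eta_0\Gamma_{\mathsf X}(\rho_0)-\eta_1\Gamma_{\mathsf X}(\rho_1)\succeq 0$, then for every positive integer $L$ both maxima are attained and $$p_{\mathsf X}(\mathcal E^{(L)})=q_{\mathsf X}(\mathcal E^{(L)})=\tfrac12+\tfrac12(2\eta_0-1)^L=\eta_0^{(L)}.$$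 -/

import Mathlib

open scoped ComplexOrder

namespace DataHiding

/-- Operators on `⨂ k, ℂ^(S k)`, where `S k` labels an orthonormal basis of the `k`-th tensor
factor, written as matrices in the product basis. -/
abbrev Op {κ : Type} (S : κ → Type) : Type :=
  Matrix (∀ k, S k) (∀ k, S k) ℂ

/-- The tensor product `⨂ k, K k` of operators `K k : ℂ^(S k) → ℂ^(T k)`. -/
def tensorOp {κ : Type} [Fintype κ] {S T : κ → Type} (K : ∀ k, Matrix (T k) (S k) ℂ) :
    Matrix (∀ k, T k) (∀ k, S k) ℂ :=
  Matrix.of fun x y => ∏ k, K k (x k) (y k)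

/-- Density matrices. -/
structure IsState {b : Type} [Fintype b] (ρ : Matrix b b ℂ) : Prop where
  posSemidef : ρ.PosSemidef
  trace_eq_one : ρ.trace = 1

/-- Measurements (POVMs) with outcomes `0, …, n - 1`. -/
structure IsMeasurement {b : Type} [Fintype b] [DecidableEq b] {n : ℕ}
    (M : Fin n → Matrix b b ℂ) : Prop where
  posSemidef : ∀ i, (M i).PosSemidef
  sum_eq_one : ∑ i, M i = 1

/-- `IsLOCC D M`: the family `M` is the measurement performed by a finite LOCC protocol among
parties `p : P` with local spaces `ℂ^(D p)`.

Either the protocol stops and announces a fixed outcome `i`. Or some party `p` performs a local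
measurement with Kraus operators `K c p`, `c = 0, …, r - 1`, and broadcasts the result `c`; each
other party `q` may then apply a local isometry `K c q` (for instance the identity), and the
parties go on with an LOCC protocol that depends on `c`. The local spaces `D' c` after the step may
differ from those before it, so that local ancillas can be added and local systems discarded. -/
inductive IsLOCC {P : Type} [Fintype P] [DecidableEq P] {n : ℕ} :
    (D : P → Type) → [∀ p, Fintype (D p)] → [∀ p, DecidableEq (D p)] →
    (Fin n → Op D) → Prop
  | announce (D : P → Type) [∀ p, Fintype (D p)] [∀ p, DecidableEq (D p)] (i : Fin n) :
      IsLOCC D (fun j => if j = i then 1 else 0)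
  | measure (D : P → Type) [∀ p, Fintype (D p)] [∀ p, DecidableEq (D p)]
      (p : P) (r : ℕ) (D' : Fin r → P → Type)
      [∀ c q, Fintype (D' c q)] [∀ c q, DecidableEq (D' c q)]
      (K : ∀ (c : Fin r) (q : P), Matrix (D' c q) (D q) ℂ)
      (hp : ∑ c, (K c p).conjTranspose * K c p = 1)
      (hq : ∀ c q, q ≠ p → (K c q).conjTranspose * K c q = 1)
      (N : ∀ c : Fin r, Fin n → Op (D' c))
      (hN : ∀ c, IsLOCC (D' c) (N c)) :
      IsLOCC D (fun j => ∑ c, (tensorOp (K c)).conjTranspose * N c j * tensorOp (K c))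

/-- The basis of the joint space of the players in `a`. -/
abbrev PartyBasis {m : ℕ} (S : Fin m → Type) (a : Finset (Fin m)) : Type :=
  ∀ k : {k : Fin m // k ∈ a}, S k.1

/-- Regrouping of the tensor factors according to a partition `X` of the players: the bijection
from the product basis of the players to the product basis of the parties of `X`. -/
def regroup {m : ℕ} {S : Fin m → Type} (X : Finpartition (Finset.univ : Finset (Fin m)))
    (x : ∀ k, S k) : ∀ a : {a // a ∈ X.parts}, PartyBasis S a.1 :=
  fun _ k => x k.1

/-- `X`-LOCC measurements: LOCC among the parties (elements) of the partition `X`. -/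
def IsPartitionLOCC {m n : ℕ} {S : Fin m → Type} [∀ k, Fintype (S k)] [∀ k, DecidableEq (S k)]
    (X : Finpartition (Finset.univ : Finset (Fin m))) (M : Fin n → Op S) : Prop :=
  ∃ N : Fin n → Op (fun a : {a // a ∈ X.parts} => PartyBasis S a.1),
    IsLOCC (fun a : {a // a ∈ X.parts} => PartyBasis S a.1) N ∧
      ∀ i, M i = (N i).submatrix (regroup X) (regroup X)

/-- Partial transposition on the tensor factors of the players in `a`. -/
def partialTranspose {m : ℕ} {S : Fin m → Type} (a : Finset (Fin m)) (ρ : Op S) : Op S :=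
  Matrix.of fun x y => ρ (a.piecewise y x) (a.piecewise x y)

/-- The data of a family `{η i, ρ i}` for `i = 0, …, n - 1`. -/
structure Ensemble (n : ℕ) {m : ℕ} (S : Fin m → Type) where
  prob : Fin n → ℝ
  state : Fin n → Op S

namespace Ensemble

variable {n m : ℕ} {S : Fin m → Type} [∀ k, Fintype (S k)] [∀ k, DecidableEq (S k)]

/-- The data form a quantum state ensemble. -/
structure IsValid (E : Ensemble n S) : Prop where
  prob_nonneg : ∀ i, 0 ≤ E.prob i
  sum_prob : ∑ i, E.prob i = 1
  isState : ∀ i, IsState (E.state i)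

/-- The average probability `∑ i, η i Tr (ρ i M i)` of a correct guess. -/
def success (E : Ensemble n S) (M : Fin n → Op S) : ℝ :=
  ∑ i, E.prob i * (E.state i * M i).trace.re

/-- The same expression with partially transposed states, `∑ i, η i Tr (Γ(ρ i) M i)`. -/
def ptSuccess (a : Finset (Fin m)) (E : Ensemble n S) (M : Fin n → Op S) : ℝ :=
  ∑ i, E.prob i * (partialTranspose a (E.state i) * M i).trace.re

/-- The success probabilities of all `X`-LOCC measurements. -/
def loccValues (X : Finpartition (Finset.univ : Finset (Fin m))) (E : Ensemble n S) : Set ℝ :=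
  {v | ∃ M : Fin n → Op S, IsPartitionLOCC X M ∧ v = E.success M}

/-- The values `∑ i, η i Tr (Γ(ρ i) M i)` for all measurements. -/
def ptValues (a : Finset (Fin m)) (E : Ensemble n S) : Set ℝ :=
  {v | ∃ M : Fin n → Op S, IsMeasurement M ∧ v = E.ptSuccess a M}

/-- The optimal success probability `p_X(E)` of `X`-LOCC measurements. -/
noncomputable def pX (X : Finpartition (Finset.univ : Finset (Fin m))) (E : Ensemble n S) : ℝ :=
  sSup (loccValues X E)

/-- The quantity `q_X(E)` for the bipartition `X = {a, aᶜ}`, with `Γ_X` transposing the party `a`.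
-/
noncomputable def qX (a : Finset (Fin m)) (E : Ensemble n S) : ℝ :=
  sSup (ptValues a E)

/-- The probability `η_c = ∏ l, η (c l)` in the `L`-fold ensemble. -/
def vecProb (E : Ensemble n S) {L : ℕ} (c : Fin L → Fin n) : ℝ :=
  ∏ l, E.prob (c l)

/-- The state `ρ_c = ⨂ l, ρ (c l)` of the `L`-fold ensemble. Player `k` holds the `k`-th factor of
each of the `L` copies, and so a space with basis `Fin L → S k`. -/
def vecState (E : Ensemble n S) {L : ℕ} (c : Fin L → Fin n) : Op (fun k => Fin L → S k) :=
  Matrix.of fun x y => ∏ l, E.state (c l) (fun k => x k l) (fun k => y k l)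

/-- The vectors in `{0, …, n - 1}^L` whose entries sum to `i` modulo `n`. -/
def vecsWithSum (n L : ℕ) (i : Fin n) : Finset (Fin L → Fin n) :=
  Finset.univ.filter fun c => (∑ l, (c l).val) % n = i.val

/-- The probability `η_i^(L)`. -/
def foldProb (E : Ensemble n S) (L : ℕ) (i : Fin n) : ℝ :=
  ∑ c ∈ vecsWithSum n L i, E.vecProb c

/-- The ensemble `E^(L)`. If `η_i^(L) = 0`, then `ρ_i^(L)` is irrelevant, and is set to `0`. -/
noncomputable def fold (E : Ensemble n S) (L : ℕ) : Ensemble n (fun k => Fin L → S k) where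
  prob i := E.foldProb L i
  state i := ((E.foldProb L i)⁻¹ : ℂ) • ∑ c ∈ vecsWithSum n L i, (E.vecProb c : ℂ) • E.vecState c

end Ensemble

end DataHiding

/-! Write `Γ` for the partial transposition. Every LOCC effect has a positive partial transpose
(`IsLOCC.sum_eq_one_and_ppt`), and `Tr (Γ(A) Γ(B)) = Tr (A B)`. Hence the success probability of an
LOCC measurement `M` is the transposed value of the POVM `Γ(M i)`, so `p ≤ q`.

To bound `q`, put `G i = Γ(η_i^(L) ρ_i^(L))`. Parity is a multiplicative sign, so `G 0 - G 1` is the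
`L`-th tensor power of `η_0 Γ(ρ_0) - η_1 Γ(ρ_1)` (`partialTranspose_foldOp_sub`), hence positive.
With `M 0 = 1 - M 1` the value is `Tr (G 0) - Tr ((G 0 - G 1) M 1) ≤ η_0^(L)`. Always announcing `0`
is LOCC and attains this bound. The same sign expansion for scalars evaluates `η_0^(L)`. -/

open scoped MatrixOrder Matrix.Norms.L2Operator in
theorem Matrix.PosSemidef.exists_eq_conjTranspose_mul_self {b : Type} [Fintype b]
    {A : Matrix b b ℂ} (hA : A.PosSemidef) : ∃ B : Matrix b b ℂ, A = B.conjTranspose * B := by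
  classical
  exact CStarAlgebra.nonneg_iff_eq_star_mul_self.mp hA.nonneg

namespace DataHiding

/-! ### Tensor products of matrices -/

section Tensor

variable {κ : Type} [Fintype κ] {S T U : κ → Type}

theorem tensorOp_mul [DecidableEq κ] [∀ k, Fintype (T k)] (A : ∀ k, Matrix (U k) (T k) ℂ)
    (B : ∀ k, Matrix (T k) (S k) ℂ) :
    tensorOp A * tensorOp B = tensorOp fun k => A k * B k := by
  ext x y
  simp only [tensorOp, Matrix.mul_apply, Matrix.of_apply, ← Finset.prod_mul_distrib]
  rw [Finset.prod_univ_sum, Fintype.piFinset_univ]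

theorem tensorOp_conjTranspose (A : ∀ k, Matrix (T k) (S k) ℂ) :
    (tensorOp A).conjTranspose = tensorOp fun k => (A k).conjTranspose := by
  ext x y
  simp [tensorOp, Matrix.conjTranspose_apply]

/-- Factorizations `Bᴴ * B` of the factors tensor to one of the product. -/
theorem tensorOp_posSemidef [DecidableEq κ] [∀ k, Fintype (S k)] {A : ∀ k, Matrix (S k) (S k) ℂ}
    (hA : ∀ k, (A k).PosSemidef) : (tensorOp A).PosSemidef := by
  classical
  choose B hB using fun k => (hA k).exists_eq_conjTranspose_mul_self
  have h : tensorOp A = (tensorOp B).conjTranspose * tensorOp B := by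
    rw [tensorOp_conjTranspose, tensorOp_mul]
    exact congrArg tensorOp (funext hB)
  rw [h]
  exact Matrix.posSemidef_conjTranspose_mul_self _

theorem trace_tensorOp [DecidableEq κ] [∀ k, Fintype (S k)] (A : ∀ k, Matrix (S k) (S k) ℂ) :
    (tensorOp A).trace = ∏ k, (A k).trace := by
  simp only [Matrix.trace, tensorOp, Matrix.diag_apply, Matrix.of_apply]
  rw [Finset.prod_univ_sum, Fintype.piFinset_univ]

end Tensor

/-! ### LOCC effects have positive partial transpose -/

section PartyTranspose

variable {P : Type} [DecidableEq P]

/-- Partial transposition on the tensor factor of a single party. -/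
def partyTranspose {D : P → Type} (p : P) (A : Op D) : Op D :=
  Matrix.of fun x y => A (Function.update x p (y p)) (Function.update y p (x p))

/-- Exchange of the `p`-th coordinates of two tuples. -/
def swapAt (D : P → Type) (p : P) : Equiv.Perm ((∀ q, D q) × (∀ q, D q)) :=
  Function.Involutive.toPerm
    (fun z => (Function.update z.1 p (z.2 p), Function.update z.2 p (z.1 p)))
    (fun z => by simp)

theorem swapAt_apply (D : P → Type) (p : P) (z : (∀ q, D q) × (∀ q, D q)) :
    swapAt D p z = (Function.update z.1 p (z.2 p), Function.update z.2 p (z.1 p)) := rfl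

theorem partyTranspose_one {D : P → Type} [∀ p, DecidableEq (D p)] [DecidableEq (∀ p, D p)]
    (p : P) : partyTranspose p (1 : Op D) = 1 := by
  ext x y
  simp only [partyTranspose, Matrix.of_apply, Matrix.one_apply]
  congr 1
  rw [eq_iff_iff]
  constructor
  · intro h
    funext q
    have hq := congrFun h q
    by_cases hqp : q = p
    · subst hqp
      simpa using hq.symm
    · simpa [hqp] using hq
  · rintro rfl
    rfl

theorem partyTranspose_sum {D : P → Type} {ι : Type} (s : Finset ι) (p : P) (A : ι → Op D) :
    partyTranspose p (∑ i ∈ s, A i) = ∑ i ∈ s, partyTranspose p (A i) := by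
  ext x y
  simp [partyTranspose, Matrix.sum_apply]

theorem conj_mul_tensorOp_apply [Fintype P] {D D' : P → Type} [∀ p, Fintype (D' p)]
    (K : ∀ q, Matrix (D' q) (D q) ℂ) (A : Op D') (x y : ∀ q, D q) :
    ((tensorOp K).conjTranspose * A * tensorOp K) x y =
      ∑ z : (∀ q, D' q) × (∀ q, D' q),
        (∏ q, star (K q (z.1 q) (x q)) * K q (z.2 q) (y q)) * A z.1 z.2 := by
  simp only [Matrix.mul_apply, Finset.sum_mul, tensorOp, Matrix.conjTranspose_apply,
    Matrix.of_apply, star_prod, Finset.prod_mul_distrib]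
  rw [Finset.sum_comm, Fintype.sum_prod_type]
  refine Finset.sum_congr rfl fun u _ => Finset.sum_congr rfl fun v _ => ?_
  ring

/-- Transposing factor `p` exchanges the left and right copies of `K p`, which amounts to
conjugating its entries. The result is again a congruence, so positivity passes through each LOCC
round. -/
theorem partyTranspose_conj_mul_tensorOp [Fintype P] {D D' : P → Type} [∀ p, Fintype (D' p)]
    (p : P) (K : ∀ q, Matrix (D' q) (D q) ℂ) (A : Op D') :
    partyTranspose p ((tensorOp K).conjTranspose * A * tensorOp K) =
      (tensorOp (Function.update K p ((K p).map star))).conjTranspose * partyTranspose p A *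
        tensorOp (Function.update K p ((K p).map star)) := by
  ext x y
  rw [conj_mul_tensorOp_apply, partyTranspose, Matrix.of_apply, conj_mul_tensorOp_apply]
  refine (Fintype.sum_equiv (swapAt D' p) _ _ fun z => ?_)
  simp only [swapAt_apply, partyTranspose, Matrix.of_apply,
    Function.update_self, Function.update_idem, Function.update_eq_self]
  congr 1
  refine Finset.prod_congr rfl fun q _ => ?_
  by_cases hq : q = p
  · subst hq
    simp [mul_comm]
  · simp [hq]

/-- Only the factor of `p` depends on the outcome; the isometries contribute identities, so the sum
acts on that factor alone. -/
theorem sum_conj_mul_tensorOp [Fintype P] {D : P → Type} [∀ p, DecidableEq (D p)]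
    {r : ℕ} {D' : Fin r → P → Type} [∀ c q, Fintype (D' c q)] (p : P)
    (K : ∀ (c : Fin r) (q : P), Matrix (D' c q) (D q) ℂ)
    (hp : ∑ c, (K c p).conjTranspose * K c p = 1)
    (hq : ∀ c q, q ≠ p → (K c q).conjTranspose * K c q = 1) :
    ∑ c, (tensorOp (K c)).conjTranspose * tensorOp (K c) = 1 := by
  ext x y
  have h : ∀ c, ((tensorOp (K c)).conjTranspose * tensorOp (K c)) x y =
      ((K c p).conjTranspose * K c p) (x p) (y p) *
        ∏ q ∈ Finset.univ.erase p, (1 : Matrix (D q) (D q) ℂ) (x q) (y q) := by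
    intro c
    rw [tensorOp_conjTranspose, tensorOp_mul, tensorOp, Matrix.of_apply,
      ← Finset.mul_prod_erase _ _ (Finset.mem_univ p)]
    congr 1
    refine Finset.prod_congr rfl fun q hqp => ?_
    rw [hq c q (Finset.ne_of_mem_erase hqp)]
  simp only [Matrix.sum_apply, h]
  rw [← Finset.sum_mul, ← Matrix.sum_apply, hp,
    Finset.mul_prod_erase Finset.univ (fun q => (1 : Matrix (D q) (D q) ℂ) (x q) (y q))
      (Finset.mem_univ p)]
  simp only [Matrix.one_apply, Finset.prod_ite_zero, Finset.prod_const_one, Finset.mem_univ,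
    true_imp_iff, funext_iff]

/-- The effects of an LOCC measurement sum to the identity and have positive partial transposes. -/
theorem IsLOCC.sum_eq_one_and_ppt [Fintype P] {n : ℕ} {D : P → Type} [∀ p, Fintype (D p)]
    [∀ p, DecidableEq (D p)] {M : Fin n → Op D} (hM : IsLOCC D M) (p : P) :
    ∑ i, M i = 1 ∧ ∀ i, (partyTranspose p (M i)).PosSemidef := by
  induction hM with
  | announce D i =>
    refine ⟨by simp, fun j => ?_⟩
    by_cases h : j = i
    · simpa [h, partyTranspose_one] using Matrix.PosSemidef.one
    · have h0 : partyTranspose p (0 : Op D) = 0 := by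
        ext x y
        simp [partyTranspose]
      simpa [h, h0] using Matrix.PosSemidef.zero
  | measure D p' r D' K hp hq N hN ih =>
    refine ⟨?_, fun j => ?_⟩
    · rw [Finset.sum_comm, ← sum_conj_mul_tensorOp p' K hp hq]
      refine Finset.sum_congr rfl fun c _ => ?_
      rw [← Matrix.sum_mul, ← Matrix.mul_sum, (ih c).1, Matrix.mul_one]
    · rw [partyTranspose_sum]
      refine Matrix.posSemidef_sum _ fun c _ => ?_
      rw [partyTranspose_conj_mul_tensorOp]
      exact ((ih c).2 j).conjTranspose_mul_mul_same _

end PartyTranspose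

/-! ### Partial transposition of the players in one part -/

section PartialTranspose

variable {m n : ℕ} {S : Fin m → Type}

theorem regroup_injective (X : Finpartition (Finset.univ : Finset (Fin m))) :
    Function.Injective (regroup (S := S) X) := by
  intro x y h
  funext k
  obtain ⟨b, hb, hk⟩ := X.exists_mem (Finset.mem_univ k)
  exact congrFun (congrFun h ⟨b, hb⟩) ⟨k, hk⟩

theorem regroup_piecewise (X : Finpartition (Finset.univ : Finset (Fin m))) (a : Finset (Fin m))
    (ha : a ∈ X.parts) (x y : ∀ k, S k) :
    regroup X (a.piecewise y x) =
      Function.update (regroup X x) ⟨a, ha⟩ (regroup X y ⟨a, ha⟩) := by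
  funext b k
  by_cases hb : b = ⟨a, ha⟩
  · subst hb
    simp [regroup, k.2]
  · have hk : k.1 ∉ a := fun hka =>
      hb (Subtype.ext (X.eq_of_mem_parts b.2 ha k.2 hka))
    simp [regroup, hb, hk]

theorem partialTranspose_submatrix_regroup (X : Finpartition (Finset.univ : Finset (Fin m)))
    (a : Finset (Fin m)) (ha : a ∈ X.parts)
    (N : Op (fun a : {a // a ∈ X.parts} => PartyBasis S a.1)) :
    partialTranspose a (N.submatrix (regroup X) (regroup X)) =
      (partyTranspose ⟨a, ha⟩ N).submatrix (regroup X) (regroup X) := by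
  ext x y
  simp only [partialTranspose, Matrix.of_apply, Matrix.submatrix_apply, partyTranspose,
    regroup_piecewise X a ha]

/-- Exchange of the coordinates in `a` of two tuples. -/
def swapOn (S : Fin m → Type) (a : Finset (Fin m)) : Equiv.Perm ((∀ k, S k) × (∀ k, S k)) :=
  Function.Involutive.toPerm (fun z => (a.piecewise z.2 z.1, a.piecewise z.1 z.2))
    (fun z => by simp [Finset.piecewise_same])

theorem partialTranspose_one [∀ k, DecidableEq (S k)] (a : Finset (Fin m)) :
    partialTranspose a (1 : Op S) = 1 := by
  ext x y
  simp only [partialTranspose, Matrix.of_apply, Matrix.one_apply]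
  congr 1
  rw [eq_iff_iff]
  constructor
  · intro h
    funext k
    have hk := congrFun h k
    by_cases hka : k ∈ a
    · simpa [hka] using hk.symm
    · simpa [hka] using hk
  · rintro rfl
    rfl

variable [∀ k, Fintype (S k)]

/-- The trace is a sum over pairs of indices, and exchanging their coordinates in `a` permutes these
pairs. -/
theorem trace_partialTranspose_mul (a : Finset (Fin m)) (A B : Op S) :
    (partialTranspose a A * partialTranspose a B).trace = (A * B).trace := by
  simp only [Matrix.trace, Matrix.diag_apply, Matrix.mul_apply, partialTranspose, Matrix.of_apply]
  rw [← Fintype.sum_prod_type', ← Fintype.sum_prod_type']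
  exact Fintype.sum_equiv (swapOn S a) _ _ fun z => rfl

theorem trace_partialTranspose (a : Finset (Fin m)) (A : Op S) :
    (partialTranspose a A).trace = A.trace := by
  simp [Matrix.trace, partialTranspose, Finset.piecewise_same]

/-- The map `partialTranspose a` as a linear map. -/
def partialTransposeLin (S : Fin m → Type) (a : Finset (Fin m)) : Op S →ₗ[ℂ] Op S where
  toFun := partialTranspose a
  map_add' _ _ := rfl
  map_smul' _ _ := rfl

theorem IsPartitionLOCC.isMeasurement_partialTranspose [∀ k, DecidableEq (S k)]
    {X : Finpartition (Finset.univ : Finset (Fin m))} {M : Fin n → Op S}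
    (hM : IsPartitionLOCC X M) {a : Finset (Fin m)} (ha : a ∈ X.parts) :
    IsMeasurement fun i => partialTranspose a (M i) := by
  obtain ⟨N, hN, hMN⟩ := hM
  obtain ⟨hsum, hppt⟩ := hN.sum_eq_one_and_ppt ⟨a, ha⟩
  refine ⟨fun i => ?_, ?_⟩
  · rw [hMN, partialTranspose_submatrix_regroup X a ha]
    exact (hppt i).submatrix _
  · have h : ∑ i, M i = 1 := by
      rw [← Matrix.submatrix_one _ (regroup_injective (S := S) X), ← hsum]
      ext x y
      simp [hMN, Matrix.sum_apply]
    rw [← partialTranspose_one a, ← h]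
    exact (map_sum (partialTransposeLin S a) M Finset.univ).symm

theorem isPartitionLOCC_announce [∀ k, DecidableEq (S k)]
    (X : Finpartition (Finset.univ : Finset (Fin m))) (i : Fin n) :
    IsPartitionLOCC X (fun j => if j = i then (1 : Op S) else 0) := by
  refine ⟨_, IsLOCC.announce _ i, fun j => ?_⟩
  by_cases h : j = i
  · simp [h, Matrix.submatrix_one _ (regroup_injective (S := S) X)]
  · simp [h]

end PartialTranspose

theorem _root_.Matrix.PosSemidef.trace_mul_re_nonneg {b : Type} [Fintype b] {A B : Matrix b b ℂ}
    (hA : A.PosSemidef) (hB : B.PosSemidef) : 0 ≤ (A * B).trace.re := by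
  classical
  obtain ⟨C, rfl⟩ := hB.exists_eq_conjTranspose_mul_self
  rw [← Matrix.mul_assoc, Matrix.trace_mul_comm, ← Matrix.mul_assoc]
  exact (Complex.nonneg_iff.mp (hA.mul_mul_conjTranspose_same C).trace_nonneg).1

/-! ### The parity ensemble -/

namespace Ensemble

variable {m : ℕ} {S : Fin m → Type}

section Sums

variable {A : Type*} [AddCommGroup A]

theorem sum_vecsWithSum_add (L : ℕ) (g : (Fin L → Fin 2) → A) :
    ∑ c ∈ vecsWithSum 2 L 0, g c + ∑ c ∈ vecsWithSum 2 L 1, g c = ∑ c, g c := by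
  rw [← Finset.sum_filter_add_sum_filter_not Finset.univ
    (fun c : Fin L → Fin 2 => (∑ l, (c l).val) % 2 = 0)]
  simp [vecsWithSum]

/-- The parity sign is a product over the copies, which lets the signed sum factor when `g` does. It
is used for real probabilities and for complex operators. -/
theorem sum_vecsWithSum_sub {R : Type*} [CommRing R] [Module R A] (L : ℕ)
    (g : (Fin L → Fin 2) → A) :
    ∑ c ∈ vecsWithSum 2 L 0, g c - ∑ c ∈ vecsWithSum 2 L 1, g c =
      ∑ c, (∏ l, (-1 : R) ^ (c l).val) • g c := by
  rw [← sum_vecsWithSum_add L fun c => (∏ l, (-1 : R) ^ (c l).val) • g c, sub_eq_add_neg,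
    ← Finset.sum_neg_distrib]
  congr 1
  · refine Finset.sum_congr rfl fun c hc => ?_
    rw [Finset.prod_pow_eq_pow_sum,
      Even.neg_one_pow (Nat.even_iff.mpr (by simpa [vecsWithSum] using hc)), one_smul]
  · refine Finset.sum_congr rfl fun c hc => ?_
    rw [Finset.prod_pow_eq_pow_sum,
      Odd.neg_one_pow (Nat.odd_iff.mpr (by simpa [vecsWithSum] using hc)), neg_one_smul]

theorem sum_prod_eq_prod_sum {R : Type*} [CommRing R] {n L : ℕ} (f : Fin L → Fin n → R) :
    ∑ c : Fin L → Fin n, ∏ l, f l (c l) = ∏ l, ∑ i, f l i := by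
  rw [Finset.prod_univ_sum, Fintype.piFinset_univ]

end Sums

theorem foldProb_zero (E : Ensemble 2 S) (hsum : ∑ i, E.prob i = 1) (L : ℕ) :
    E.foldProb L 0 = 1 / 2 + 1 / 2 * (2 * E.prob 0 - 1) ^ L := by
  have h1 : E.foldProb L 0 + E.foldProb L 1 = 1 := by
    rw [foldProb, foldProb, sum_vecsWithSum_add]
    simp only [vecProb, sum_prod_eq_prod_sum fun _ => E.prob, hsum, Finset.prod_const_one]
  have h2 : E.foldProb L 0 - E.foldProb L 1 = (2 * E.prob 0 - 1) ^ L := by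
    rw [foldProb, foldProb, sum_vecsWithSum_sub (R := ℝ)]
    simp only [vecProb, smul_eq_mul, ← Finset.prod_mul_distrib]
    rw [sum_prod_eq_prod_sum fun _ i => (-1) ^ i.val * E.prob i]
    have h : ∑ i : Fin 2, (-1) ^ i.val * E.prob i = 2 * E.prob 0 - 1 := by
      rw [Fin.sum_univ_two] at hsum ⊢
      simp only [Fin.val_zero, Fin.val_one, pow_zero, pow_one]
      linarith
    simp [h]
  linarith

/-- The unnormalized state `η_i^(L) ρ_i^(L)`. -/
noncomputable def foldOp {n : ℕ} (E : Ensemble n S) (L : ℕ) (i : Fin n) :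
    Op (fun k => Fin L → S k) :=
  ∑ c ∈ vecsWithSum n L i, (E.vecProb c : ℂ) • E.vecState c

theorem fold_prob_smul_state {n : ℕ} (E : Ensemble n S) (h0 : ∀ i, 0 ≤ E.prob i) (L : ℕ)
    (i : Fin n) : (((E.fold L).prob i : ℝ) : ℂ) • (E.fold L).state i = E.foldOp L i := by
  change ((E.foldProb L i : ℝ) : ℂ) • (((E.foldProb L i)⁻¹ : ℂ) • E.foldOp L i) = _
  by_cases h : E.foldProb L i = 0
  -- A vanishing sum of nonnegative weights has only zero terms, so the value assigned to the state
  -- does not matter.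
  · have hc : ∀ c ∈ vecsWithSum n L i, E.vecProb c = 0 :=
      (Finset.sum_eq_zero_iff_of_nonneg fun c _ => Finset.prod_nonneg fun l _ => h0 (c l)).mp h
    have hz : E.foldOp L i = 0 := Finset.sum_eq_zero fun c hcm => by rw [hc c hcm]; simp
    simp [hz]
  · exact smul_inv_smul₀ (by exact_mod_cast h) _

/-- Collecting the indices of each copy. -/
def copies (S : Fin m → Type) (L : ℕ) : (∀ k, Fin L → S k) ≃ (Fin L → ∀ k, S k) :=
  Equiv.piComm _

/-- The same players are transposed in every copy, so the transposition acts copy by copy. -/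
theorem partialTranspose_vecState {n : ℕ} (E : Ensemble n S) (a : Finset (Fin m)) {L : ℕ}
    (c : Fin L → Fin n) :
    partialTranspose a (E.vecState c) =
      (tensorOp fun l => partialTranspose a (E.state (c l))).submatrix
        (copies S L) (copies S L) := by
  have h : ∀ (x y : ∀ k, Fin L → S k) (l : Fin L),
      (fun k => a.piecewise x y k l) = a.piecewise (fun k => x k l) (fun k => y k l) := by
    intro x y l
    funext k
    by_cases hk : k ∈ a <;> simp [hk]
  ext x y
  simp only [partialTranspose, vecState, tensorOp, Matrix.of_apply, Matrix.submatrix_apply, h]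
  rfl

theorem partialTranspose_foldOp {n : ℕ} (E : Ensemble n S) (a : Finset (Fin m)) (L : ℕ)
    (i : Fin n) : partialTranspose a (E.foldOp L i) =
      ∑ c ∈ vecsWithSum n L i, (E.vecProb c : ℂ) • partialTranspose a (E.vecState c) := by
  have h := map_sum (partialTransposeLin (fun k => Fin L → S k) a)
    (fun c => (E.vecProb c : ℂ) • E.vecState c) (vecsWithSum n L i)
  simp only [map_smul] at h
  exact h

theorem partialTranspose_foldOp_sub (E : Ensemble 2 S) (a : Finset (Fin m)) (L : ℕ) :
    partialTranspose a (E.foldOp L 0) - partialTranspose a (E.foldOp L 1) =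
      (tensorOp fun _ : Fin L => (E.prob 0 : ℂ) • partialTranspose a (E.state 0)
        - (E.prob 1 : ℂ) • partialTranspose a (E.state 1)).submatrix
        (copies S L) (copies S L) := by
  rw [partialTranspose_foldOp, partialTranspose_foldOp, sum_vecsWithSum_sub (R := ℂ)]
  ext x y
  simp only [partialTranspose_vecState, Matrix.sum_apply, Matrix.smul_apply,
    Matrix.submatrix_apply, tensorOp, Matrix.of_apply, vecProb, Complex.ofReal_prod, smul_eq_mul,
    ← Finset.prod_mul_distrib]
  rw [sum_prod_eq_prod_sum fun l i => (-1 : ℂ) ^ i.val * ((E.prob i : ℂ) *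
    partialTranspose a (E.state i) (copies S L x l) (copies S L y l))]
  refine Finset.prod_congr rfl fun l _ => ?_
  simp [Fin.sum_univ_two, sub_eq_add_neg]

variable [∀ k, Fintype (S k)]

theorem trace_foldOp {n : ℕ} (E : Ensemble n S) (hE : ∀ i, (E.state i).trace = 1) (L : ℕ)
    (i : Fin n) : (E.foldOp L i).trace = (E.foldProb L i : ℂ) := by
  have h : ∀ c : Fin L → Fin n, (E.vecState c).trace = 1 := by
    intro c
    have ht : (E.vecState c).trace = (tensorOp fun l => E.state (c l)).trace :=
      Fintype.sum_equiv (copies S L) _ _ fun x => rfl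
    rw [ht, trace_tensorOp]
    simp [hE]
  simp [foldOp, Matrix.trace_sum, Matrix.trace_smul, h, foldProb]

theorem success_eq_ptSuccess {n : ℕ} (E : Ensemble n S) (a : Finset (Fin m)) (M : Fin n → Op S) :
    E.success M = E.ptSuccess a fun i => partialTranspose a (M i) := by
  simp only [success, ptSuccess, trace_partialTranspose_mul]

theorem ptSuccess_fold {n : ℕ} (E : Ensemble n S) (h0 : ∀ i, 0 ≤ E.prob i) (a : Finset (Fin m))
    (L : ℕ) (M : Fin n → Op fun k => Fin L → S k) :
    (E.fold L).ptSuccess a M = ∑ i, (partialTranspose a (E.foldOp L i) * M i).trace.re := by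
  refine Finset.sum_congr rfl fun i _ => ?_
  have h : partialTranspose a (E.foldOp L i) =
      (((E.fold L).prob i : ℝ) : ℂ) • partialTranspose a ((E.fold L).state i) := by
    rw [← fold_prob_smul_state E h0]
    rfl
  rw [h, Matrix.smul_mul, Matrix.trace_smul, smul_eq_mul, Complex.re_ofReal_mul]

variable [∀ k, DecidableEq (S k)]

theorem loccValues_subset_ptValues {n : ℕ} (E : Ensemble n S)
    {X : Finpartition (Finset.univ : Finset (Fin m))} {a : Finset (Fin m)} (ha : a ∈ X.parts) :
    E.loccValues X ⊆ E.ptValues a := by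
  rintro v ⟨M, hM, rfl⟩
  exact ⟨_, hM.isMeasurement_partialTranspose ha, E.success_eq_ptSuccess a M⟩

/-- No measurement does better than always guessing `0`. -/
theorem foldProb_mem_upperBounds_ptValues (E : Ensemble 2 S) (hE : E.IsValid) (a : Finset (Fin m))
    (hcond : Matrix.PosSemidef ((E.prob 0 : ℂ) • partialTranspose a (E.state 0)
      - (E.prob 1 : ℂ) • partialTranspose a (E.state 1))) (L : ℕ) :
    E.foldProb L 0 ∈ upperBounds ((E.fold L).ptValues a) := by
  rintro v ⟨M, hM, rfl⟩
  have hpos : (partialTranspose a (E.foldOp L 0) -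
      partialTranspose a (E.foldOp L 1)).PosSemidef := by
    rw [partialTranspose_foldOp_sub]
    exact (tensorOp_posSemidef fun _ => hcond).submatrix _
  have h0 : M 0 = 1 - M 1 := by
    rw [← hM.sum_eq_one, Fin.sum_univ_two, add_sub_cancel_right]
  have ht : (partialTranspose a (E.foldOp L 0)).trace.re = E.foldProb L 0 := by
    rw [trace_partialTranspose, E.trace_foldOp fun i => (hE.isState i).trace_eq_one]
    rfl
  -- This trace is exactly the loss relative to always guessing `0`.
  have hnn := hpos.trace_mul_re_nonneg (hM.posSemidef 1)
  rw [Matrix.sub_mul, Matrix.trace_sub, Complex.sub_re] at hnn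
  rw [E.ptSuccess_fold hE.prob_nonneg, Fin.sum_univ_two, h0, Matrix.mul_sub, Matrix.mul_one,
    Matrix.trace_sub, Complex.sub_re, ht]
  linarith

theorem foldProb_mem_loccValues (E : Ensemble 2 S) (hE : E.IsValid)
    (X : Finpartition (Finset.univ : Finset (Fin m))) (L : ℕ) :
    E.foldProb L 0 ∈ (E.fold L).loccValues X := by
  refine ⟨_, isPartitionLOCC_announce X 0, ?_⟩
  have h : (((E.fold L).prob 0 : ℝ) : ℂ) * ((E.fold L).state 0).trace = E.foldProb L 0 := by
    rw [← E.trace_foldOp (fun i => (hE.isState i).trace_eq_one) L 0,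
      ← fold_prob_smul_state E hE.prob_nonneg, Matrix.trace_smul, smul_eq_mul]
  have hre := congrArg Complex.re h
  rw [Complex.re_ofReal_mul, Complex.ofReal_re] at hre
  simp [success, Fin.sum_univ_two, hre]

end Ensemble

end DataHiding

theorem corollary1 {m : ℕ} (d : Fin m → ℕ)
    (E : DataHiding.Ensemble 2 (fun k : Fin m => Fin (d k))) (hE : E.IsValid)
    (X : Finpartition (Finset.univ : Finset (Fin m))) (hX : X.parts.card = 2)
    (a : Finset (Fin m)) (ha : a ∈ X.parts)
    (hcond : Matrix.PosSemidef
      ((E.prob 0 : ℂ) • DataHiding.partialTranspose a (E.state 0)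
        - (E.prob 1 : ℂ) • DataHiding.partialTranspose a (E.state 1)))
    (L : ℕ) (hL : 0 < L) :
    ((E.fold L).pX X = (E.fold L).qX a ∧
      (E.fold L).qX a = 1 / 2 + 1 / 2 * (2 * E.prob 0 - 1) ^ L ∧
      1 / 2 + 1 / 2 * (2 * E.prob 0 - 1) ^ L = (E.fold L).prob 0) ∧
    IsGreatest ((E.fold L).loccValues X) ((E.fold L).pX X) ∧
    IsGreatest ((E.fold L).ptValues a) ((E.fold L).qX a) := by
  have hmem := E.foldProb_mem_loccValues hE X L
  have hub := E.foldProb_mem_upperBounds_ptValues hE a hcond L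
  have hsub := (E.fold L).loccValues_subset_ptValues ha
  -- One value, lying in the smaller set and bounding the larger, is the maximum of both.
  have hp : IsGreatest ((E.fold L).loccValues X) (E.foldProb L 0) :=
    ⟨hmem, fun v hv => hub (hsub hv)⟩
  have hq : IsGreatest ((E.fold L).ptValues a) (E.foldProb L 0) := ⟨hsub hmem, hub⟩
  have hpX : (E.fold L).pX X = E.foldProb L 0 := hp.csSup_eq
  have hqX : (E.fold L).qX a = E.foldProb L 0 := hq.csSup_eq
  have hf := E.foldProb_zero hE.sum_prob L
  rw [hpX, hqX]
  exact ⟨⟨rfl, hf, hf.symm⟩, hp, hq⟩
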